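/- All algebras and vector spaces are over $\mathbb{C}$. A unital Hilbert algebra is a unital $*$-algebra $A$ together with an inner product $\langle\cdot,\cdot\rangle$, with norm $\|x\|=\langle x,x\rangle^{1/2}$, such that (i) for each $x\in A$ the map $y\mapsto xy$ is bounded; (ii) $\langle xy,z\rangle=\langle y,x^*z\rangle$ for all $x,y,z\in A$; (iii) the linear span of $\{xy: x,y\in A\}$ is dense in $A$; (iv) $\|x^*\|=\|x\|$ for all $x\in A$. Let $I$ be an infinite set and let $\{A_i\}_{i\in I}$ be a family of unital $*$-algebras with identities $e_i$. Let $\bigotimes_{i\in I}A_i$ be the algebraic tensor product (the universal vector space for maps on $\prod_{i\in I} A_i$ that are linear in each variable), which is a unital $*$-algebra with $(\otimes_i a_i)(\otimes_i b_i)=\otimes_i a_ib_i$ and $(\otimes_i a_i)^*=\otimes_i a_i^*$. For a family $u=(u_i)_{i\in I}$ of unitaries $u_i\in A_i$ (that is, $u_i^*u_i=e_i=u_iu_i^*$), let $\bigotimes^{u}_{i\in I} A_i$ be the linear span of all $\otimes_i a_i$ with $a_i=u_i$ for all but finitely many $i$, and let $$\bigotimes\nolimits^{\rm ut}_{i\in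 I}A_i:=\sum_{u}\bigotimes\nolimits^{u}_{i\in I}A_i ,$$ the sum being over all such families $u$; this is a unital $*$-subalgebra of $\bigotimes_{i\in I}A_i$. Let $\phi_1:\bigotimes_{i\in I}\mathbb{C}\to\mathbb{C}$ be the linear functional with $\phi_1(\otimes_i\beta_i)=\prod_{i}\beta_i$ if $\beta_i=1$ for all but finitely many $i$, and $\phi_1(\otimes_i\beta_i)=0$ otherwise. If each $A_i$ carries an inner product, let $\langle\cdot,\cdot\rangle_{\phi_1}$ be the sesquilinear form on $\bigotimes_{i\in I} A_i$ with $\langle\otimes_i x_i,\otimes_i y_i\rangle_{\phi_1}=\phi_1(\otimes_i\langle x_i,y_i\rangle)$. **Corollary.** Let $\{A_i\}_{i\in I}$ be a family of unital Hilbert algebras such that $\|e_i\|=1$ for every $i\in I$. Then the restriction of $\langle\cdot,\cdot\rangle_{\phi_1}$ to $\bigotimes^{\rm ut}_{i\in I}A_i$ is an inner product, $\bigotimes^{\rm ut}_{i\in I}A_i$ with this inner product is a unital Hilbert algebra, and $\|\otimes_i e_i\|=1$. -/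

import Mathlib

open scoped TensorProduct ComplexConjugate

noncomputable section

namespace InfTensor

universe u v

/-! ### Hilbert algebras -/

section HilbertAlgebra

variable {A : Type v} [Ring A] [StarRing A] [Algebra ℂ A]

/-- The norm `‖x‖ = √⟨x, x⟩` of an inner product `c`. -/
def hNorm (c : InnerProductSpace.Core ℂ A) (x : A) : ℝ :=
  √(c.inner x x).re

/-- A unital `*`-algebra `A` over `ℂ` with an inner product `c` is a (unital) Hilbert algebra if
left multiplications are bounded, `⟨x y, z⟩ = ⟨y, x* z⟩`, the span of all products is dense, and
the involution is isometric (so it is automatically closable). -/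
structure IsHilbertAlgebra (c : InnerProductSpace.Core ℂ A) : Prop where
  bounded_mul_left : ∀ x : A, ∃ C : ℝ, ∀ y : A, hNorm c (x * y) ≤ C * hNorm c y
  inner_mul_left : ∀ x y z : A, c.inner (x * y) z = c.inner y (star x * z)
  dense_mul : ∀ x : A, ∀ ε > 0,
    ∃ y ∈ Submodule.span ℂ {w : A | ∃ a b : A, w = a * b}, hNorm c (x - y) < ε
  norm_star : ∀ x : A, hNorm c (star x) = hNorm c x

end HilbertAlgebra

/-! ### The functional `φ₁` on `ℂ^{⊗I}` -/

section Phi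

variable {I : Type u}

open Classical in
/-- `φ₁ β = ∏ i, β i` if `β i = 1` for all but finitely many `i`, and `φ₁ β = 0` otherwise. -/
def phiOneFun (β : I → ℂ) : ℂ :=
  if {i | β i ≠ 1}.Finite then ∏ᶠ i, β i else 0

theorem finite_update_iff [DecidableEq I] (β : I → ℂ) (i : I) (x : ℂ) :
    {j | Function.update β i x j ≠ 1}.Finite ↔ {j | β j ≠ 1}.Finite := by
  have key : ∀ (γ δ : I → ℂ), (∀ j, j ≠ i → γ j = δ j) →
      {j | γ j ≠ 1}.Finite → {j | δ j ≠ 1}.Finite := by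
    intro γ δ h hf
    refine (hf.union (Set.finite_singleton i)).subset fun j hj => ?_
    by_cases hji : j = i
    · exact Or.inr hji
    · left
      simpa [h j hji] using hj
  constructor
  · exact key _ _ fun j hj => by simp [Function.update_of_ne hj]
  · exact key _ _ fun j hj => by simp [Function.update_of_ne hj]

theorem phiOneFun_update [DecidableEq I] (β : I → ℂ) (i : I) (x : ℂ) :
    phiOneFun (Function.update β i x) = x * phiOneFun (Function.update β i 1) := by
  by_cases h : {j | β j ≠ 1}.Finite
  · rw [phiOneFun, phiOneFun, if_pos ((finite_update_iff β i x).2 h),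
      if_pos ((finite_update_iff β i 1).2 h)]
    have h1 : (Function.mulSupport (Function.update β i 1)).Finite :=
      (finite_update_iff β i 1).2 h
    have h2 : (Function.mulSupport (Pi.mulSingle i x : I → ℂ)).Finite :=
      (Set.finite_singleton i).subset Pi.mulSupport_mulSingle_subset
    have e : Function.update β i x = (Pi.mulSingle i x : I → ℂ) * Function.update β i 1 := by
      funext j
      by_cases hj : j = i
      · subst hj; simp
      · simp [hj]
    have e3 : ∏ᶠ j, (Pi.mulSingle i x : I → ℂ) j = x := by
      rw [finprod_eq_single _ i (fun j hj => by simp [hj])]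
      simp
    rw [e]
    simp only [Pi.mul_apply]
    rw [finprod_mul_distrib h2 h1, e3]
  · rw [phiOneFun, phiOneFun, if_neg fun h' => h ((finite_update_iff β i x).1 h'),
      if_neg fun h' => h ((finite_update_iff β i 1).1 h'), mul_zero]

/-- `φ₁` as a multilinear map. -/
def phiOneMulti (I : Type u) : MultilinearMap ℂ (fun _ : I => ℂ) ℂ where
  toFun := phiOneFun
  map_update_add' β i x y := by
    rw [phiOneFun_update β i (x + y), phiOneFun_update β i x, phiOneFun_update β i y]
    ring
  map_update_smul' β i c x := by
    rw [phiOneFun_update β i (c • x), phiOneFun_update β i x, smul_eq_mul, smul_eq_mul]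
    ring

/-- The linear functional `φ₁ : ⨂ ℂ → ℂ` induced by the multilinear map `φ₁`. -/
def phiOne (I : Type u) : (⨂[ℂ] _ : I, ℂ) →ₗ[ℂ] ℂ :=
  PiTensorProduct.lift (phiOneMulti I)

end Phi

set_option linter.unusedSectionVars false

section Algebras

variable {I : Type u} {A : I → Type v} [∀ i, Ring (A i)] [∀ i, StarRing (A i)]
  [∀ i, Algebra ℂ (A i)] [∀ i, StarModule ℂ (A i)]

/-! ### The `*`-algebra `⨂ A i` (the multiplication is the one in Mathlib) -/

/-- The additive map with `c • ⊗ a i ↦ conj c • ⊗ (a i)*`. -/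
def starAux : (⨂[ℂ] i, A i) →+ (⨂[ℂ] i, A i) :=
  PiTensorProduct.liftAddHom (fun p => conj p.1 • PiTensorProduct.tprod ℂ (star p.2))
    (fun r f i h => by
      have : PiTensorProduct.tprod ℂ (star f) = 0 :=
        MultilinearMap.map_coord_zero _ i (by simp [h])
      simp [this])
    (fun f => by simp)
    (fun r f i m₁ m₂ => by
      have h : ∀ m, star (Function.update f i m) = Function.update (star f) i (star m) := by
        intro m; funext j
        by_cases hj : j = i
        · subst hj; simp
        · simp [hj]
      simp only [h, star_add, MultilinearMap.map_update_add, smul_add])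
    (fun r r' f => by simp [add_smul])
    (fun r f i r' => by
      have h : star (Function.update f i (r' • f i)) =
          Function.update (star f) i (conj r' • star f i) := by
        funext j
        by_cases hj : j = i
        · subst hj; simp
        · simp [hj]
      simp only [h, MultilinearMap.map_update_smul, Function.update_eq_self, smul_smul, map_mul]
      rw [mul_comm])

theorem starAux_smul_tprod (c : ℂ) (a : ∀ i, A i) :
    starAux (c • PiTensorProduct.tprod ℂ a) = conj c • PiTensorProduct.tprod ℂ (star a) := by
  rw [← PiTensorProduct.tprodCoeff_eq_smul_tprod]
  rfl

instance instStarPiTensor : Star (⨂[ℂ] i, A i) := ⟨fun x => starAux x⟩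

theorem star_smul_tprod (c : ℂ) (a : ∀ i, A i) :
    star (c • PiTensorProduct.tprod ℂ a) = conj c • PiTensorProduct.tprod ℂ (star a) :=
  starAux_smul_tprod c a

theorem star_tprod (a : ∀ i, A i) :
    star (PiTensorProduct.tprod ℂ a) = PiTensorProduct.tprod ℂ (star a) := by
  simpa using star_smul_tprod 1 a

theorem tensor_star_add (x y : ⨂[ℂ] i, A i) : star (x + y) = star x + star y :=
  map_add starAux x y

instance instStarRingPiTensor : StarRing (⨂[ℂ] i, A i) where
  star_involutive x := by
    induction x using PiTensorProduct.induction_on with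
    | smul_tprod c a => simp [star_smul_tprod]
    | add x y hx hy => rw [tensor_star_add, tensor_star_add, hx, hy]
  star_mul x y := by
    induction x using PiTensorProduct.induction_on with
    | smul_tprod c a =>
      induction y using PiTensorProduct.induction_on with
      | smul_tprod d b =>
        rw [PiTensorProduct.smul_tprod_mul_smul_tprod, star_smul_tprod, star_smul_tprod,
          star_smul_tprod, PiTensorProduct.smul_tprod_mul_smul_tprod, star_mul, map_mul, mul_comm]
      | add x y hx hy => rw [mul_add, tensor_star_add, hx, hy, tensor_star_add, add_mul]
    | add x z hx hz => rw [add_mul, tensor_star_add, hx, hz, tensor_star_add, mul_add]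
  star_add := tensor_star_add

instance instStarModulePiTensor : StarModule ℂ (⨂[ℂ] i, A i) where
  star_smul c x := by
    induction x using PiTensorProduct.induction_on with
    | smul_tprod d a => simp [star_smul_tprod, smul_smul]
    | add x y hx hy => rw [smul_add, tensor_star_add, hx, hy, tensor_star_add, smul_add]

/-! ### The `*`-subalgebra `⨂^ut A i` -/

/-- `⨂^u A i`, the span of all `⊗ a i` with `a i = u i` for all but finitely many `i`. -/
def tensorComponent (w : ∀ i, A i) : Submodule ℂ (⨂[ℂ] i, A i) :=
  Submodule.span ℂ
    {x | ∃ a : ∀ i, A i, {i | a i ≠ w i}.Finite ∧ x = PiTensorProduct.tprod ℂ a}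

/-- The sum of the subspaces `⨂^u A i` over all families `u` of unitaries `u i ∈ A i`. -/
def utSubmodule (A : I → Type v) [∀ i, Ring (A i)] [∀ i, StarRing (A i)]
    [∀ i, Algebra ℂ (A i)] : Submodule ℂ (⨂[ℂ] i, A i) :=
  ⨆ w : ∀ i, unitary (A i), tensorComponent fun i => (w i : A i)

theorem tprod_mem_utSubmodule (w : ∀ i, unitary (A i)) (a : ∀ i, A i)
    (h : {i | a i ≠ w i}.Finite) : PiTensorProduct.tprod ℂ a ∈ utSubmodule A :=
  Submodule.mem_iSup_of_mem w (Submodule.subset_span ⟨a, h, rfl⟩)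

theorem utSubmodule_induction {p : (⨂[ℂ] i, A i) → Prop}
    (tprod : ∀ (w : ∀ i, unitary (A i)) (a : ∀ i, A i), {i | a i ≠ w i}.Finite →
      p (PiTensorProduct.tprod ℂ a))
    (zero : p 0) (add : ∀ x y, p x → p y → p (x + y)) (smul : ∀ (c : ℂ) x, p x → p (c • x))
    {x : ⨂[ℂ] i, A i} (hx : x ∈ utSubmodule A) : p x := by
  unfold utSubmodule at hx
  refine Submodule.iSup_induction _ (motive := p) hx (fun w y hy => ?_) zero add
  refine Submodule.span_induction (p := fun y _ => p y) ?_ zero (fun x y _ _ => add x y)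
    (fun c x _ => smul c x) hy
  rintro _ ⟨a, ha, rfl⟩
  exact tprod w a ha

theorem tprod_one_mem : PiTensorProduct.tprod ℂ (fun i => (1 : A i)) ∈ utSubmodule A :=
  tprod_mem_utSubmodule (fun _ => 1) _ (by simp)

theorem ut_mul_mem {x y : ⨂[ℂ] i, A i} (hx : x ∈ utSubmodule A) (hy : y ∈ utSubmodule A) :
    x * y ∈ utSubmodule A := by
  refine utSubmodule_induction (p := fun x => x * y ∈ utSubmodule A) (fun w a ha => ?_)
    (by simp) (fun x z hx hz => by rw [add_mul]; exact add_mem hx hz)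
    (fun c x hx => by rw [smul_mul_assoc]; exact Submodule.smul_mem _ c hx) hx
  refine utSubmodule_induction (p := fun y => _ * y ∈ utSubmodule A) (fun w' b hb => ?_)
    (by simp) (fun x z hx hz => by rw [mul_add]; exact add_mem hx hz)
    (fun c x hx => by rw [mul_smul_comm]; exact Submodule.smul_mem _ c hx) hy
  rw [PiTensorProduct.tprod_mul_tprod]
  refine tprod_mem_utSubmodule (fun i => w i * w' i) _ ((ha.union hb).subset fun i hi => ?_)
  by_contra hc
  simp only [Set.mem_union, Set.mem_ofPred_eq, not_or, not_not] at hc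
  exact hi (by simp [hc.1, hc.2])

theorem ut_star_mem {x : ⨂[ℂ] i, A i} (hx : x ∈ utSubmodule A) : star x ∈ utSubmodule A := by
  refine utSubmodule_induction (p := fun x => star x ∈ utSubmodule A) (fun w a ha => ?_)
    (by simp) (fun x z hx hz => by rw [star_add]; exact add_mem hx hz)
    (fun c x hx => by rw [star_smul]; exact Submodule.smul_mem _ _ hx) hx
  rw [star_tprod]
  refine tprod_mem_utSubmodule (fun i => star (w i)) _ (ha.subset fun i hi hc => hi ?_)
  simp [hc]

/-- The unital `*`-subalgebra `⨂^ut A i` of `⨂ A i`. -/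
def utTensor (A : I → Type v) [∀ i, Ring (A i)] [∀ i, StarRing (A i)]
    [∀ i, Algebra ℂ (A i)] [∀ i, StarModule ℂ (A i)] : StarSubalgebra ℂ (⨂[ℂ] i, A i) where
  carrier := utSubmodule A
  mul_mem' := ut_mul_mem
  one_mem' := tprod_one_mem
  add_mem' := fun hx hy => add_mem hx hy
  zero_mem' := zero_mem _
  algebraMap_mem' c := by
    rw [Algebra.algebraMap_eq_smul_one]
    exact Submodule.smul_mem _ c tprod_one_mem
  star_mem' := ut_star_mem

/-- The element `⊗ e i` of `⨂^ut A i`, where `e i` is the identity of `A i`. -/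
def utUnit (A : I → Type v) [∀ i, Ring (A i)] [∀ i, StarRing (A i)]
    [∀ i, Algebra ℂ (A i)] [∀ i, StarModule ℂ (A i)] : utTensor A :=
  ⟨PiTensorProduct.tprod ℂ fun i => (1 : A i), tprod_one_mem⟩

theorem utUnit_eq_one : utUnit A = 1 := rfl

/-! ### The form `⟨·, ·⟩_{φ₁}` -/

/-- The bilinear map `(a, b) ↦ ⟨a*, b⟩`. As in Mathlib, inner products are conjugate linear in the
first variable. -/
def starInner {B : Type v} [Ring B] [StarRing B] [Algebra ℂ B] [StarModule ℂ B]
    (c : InnerProductSpace.Core ℂ B) : B →ₗ[ℂ] B →ₗ[ℂ] ℂ :=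
  letI := c
  LinearMap.mk₂ ℂ (fun a b => c.inner (star a) b)
    (fun a a' b => by rw [star_add]; exact c.add_left _ _ _)
    (fun r a b => by rw [star_smul, c.smul_left]; simp)
    (fun a b b' => InnerProductSpace.Core.inner_add_right _ _ _)
    (fun r a b => InnerProductSpace.Core.inner_smul_right _ _)

/-- The `ℂ^{⊗I}`-valued sesquilinear form on `⨂ A i` with
`⟨⊗ x i, ⊗ y i⟩ = ⊗ ⟨x i, y i⟩` (see `innerTensor_tprod`). -/
def innerTensor (c : ∀ i, InnerProductSpace.Core ℂ (A i)) :
    (⨂[ℂ] i, A i) →ₗ⋆[ℂ] (⨂[ℂ] i, A i) →ₗ[ℂ] (⨂[ℂ] _ : I, ℂ) :=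
  (PiTensorProduct.map₂ fun i => starInner (c i)).comp
    (starLinearEquiv ℂ (A := ⨂[ℂ] i, A i)).toLinearMap

theorem innerTensor_tprod (c : ∀ i, InnerProductSpace.Core ℂ (A i)) (x y : ∀ i, A i) :
    innerTensor c (PiTensorProduct.tprod ℂ x) (PiTensorProduct.tprod ℂ y) =
      PiTensorProduct.tprod ℂ fun i => (c i).inner (x i) (y i) := by
  simp [innerTensor, star_tprod, PiTensorProduct.map₂_tprod_tprod, starInner]

/-- The sesquilinear form `⟨ξ, η⟩_{φ₁} = φ₁ ⟨ξ, η⟩` on `⨂ A i`. -/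
def innerPhiOne (c : ∀ i, InnerProductSpace.Core ℂ (A i)) (ξ η : ⨂[ℂ] i, A i) : ℂ :=
  phiOne I (innerTensor c ξ η)

theorem innerPhiOne_tprod (c : ∀ i, InnerProductSpace.Core ℂ (A i)) (x y : ∀ i, A i) :
    innerPhiOne c (PiTensorProduct.tprod ℂ x) (PiTensorProduct.tprod ℂ y) =
      phiOneFun fun i => (c i).inner (x i) (y i) := by
  rw [innerPhiOne, innerTensor_tprod, phiOne, PiTensorProduct.lift.tprod]
  rfl

end Algebras

end InfTensor

end

/-! Since `‖e i‖ = 1` and unitaries act isometrically from the left, every unitary is a unit vector.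
Unit vectors with inner product `1` coincide, so elementary tensors built from unitary families that
differ at infinitely many indices are orthogonal: infinitely many of their inner products are not
`1`, and `φ₁` vanishes. Families that agree almost everywhere are compared on finitely many
coordinates, where Gram–Schmidt applies.

Fix one index `j`. By `exists_orthonormalOff`, any `x` in `⨂^ut A i` is a finite sum of tensors
whose entries away from `j` form an orthonormal system, with coefficients `f w` in `A j` placed at
`j`. Then `⟨x, x⟩ = ∑ ⟨f w, f w⟩`, so positivity and definiteness come from `A j`. Keeping the
coefficients in `A j` rather than in `ℂ` also gives boundedness: multiplication by an element of the
`j`-th factor only changes `f w` into `a * f w`. An almost unitary elementary tensor is a finite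
product of such single-factor elements and a unitary tensor, which is isometric. The algebraic
identities are checked on elementary tensors. -/

noncomputable section

namespace InfTensor

set_option linter.unusedSectionVars false

universe u v

/-! ### Inner product spaces and orthonormal sets -/

section Core

variable {B : Type v} [AddCommGroup B] [Module ℂ B]

theorem core_conj_symm (c : InnerProductSpace.Core ℂ B) (x y : B) :
    conj (c.inner y x) = c.inner x y :=
  c.conj_inner_symm x y

theorem core_add_left (c : InnerProductSpace.Core ℂ B) (x y z : B) :
    c.inner (x + y) z = c.inner x z + c.inner y z :=
  c.add_left x y z

theorem core_add_right (c : InnerProductSpace.Core ℂ B) (x y z : B) :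
    c.inner x (y + z) = c.inner x y + c.inner x z :=
  letI := c
  InnerProductSpace.Core.inner_add_right x y z

theorem core_sub_left (c : InnerProductSpace.Core ℂ B) (x y z : B) :
    c.inner (x - y) z = c.inner x z - c.inner y z :=
  letI := c
  InnerProductSpace.Core.inner_sub_left x y z

theorem core_sub_right (c : InnerProductSpace.Core ℂ B) (x y z : B) :
    c.inner x (y - z) = c.inner x y - c.inner x z :=
  letI := c
  InnerProductSpace.Core.inner_sub_right x y z

theorem core_smul_left (c : InnerProductSpace.Core ℂ B) (r : ℂ) (x y : B) :
    c.inner (r • x) y = conj r * c.inner x y :=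
  c.smul_left x y r

theorem core_smul_right (c : InnerProductSpace.Core ℂ B) (r : ℂ) (x y : B) :
    c.inner x (r • y) = r * c.inner x y :=
  letI := c
  InnerProductSpace.Core.inner_smul_right x y

theorem core_inner_self_ofReal (c : InnerProductSpace.Core ℂ B) (x : B) :
    ((c.inner x x).re : ℂ) = c.inner x x :=
  Complex.conj_eq_iff_re.1 (core_conj_symm c x x)

/-- Vectors of norm one whose inner product is one coincide. -/
theorem core_eq_of_inner_eq_one (c : InnerProductSpace.Core ℂ B) {x y : B}
    (hx : c.inner x x = 1) (hy : c.inner y y = 1) (h : c.inner x y = 1) : x = y := by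
  refine sub_eq_zero.1 (c.definite _ ?_)
  change c.inner (x - y) (x - y) = 0
  have h' : c.inner y x = 1 := by rw [← core_conj_symm, h, map_one]
  rw [core_sub_left, core_sub_right, core_sub_right, hx, hy, h, h']
  ring

/-- A finite set of vectors lies in the span of an orthonormal set. -/
theorem exists_orthonormal_span (c : InnerProductSpace.Core ℂ B) (T : Set B) (hT : T.Finite) :
    ∃ S : Set B, (∀ x ∈ S, c.inner x x = 1) ∧ (∀ x ∈ S, ∀ y ∈ S, x ≠ y → c.inner x y = 0) ∧
      T ⊆ Submodule.span ℂ S := by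
  let : NormedAddCommGroup B := @InnerProductSpace.Core.toNormedAddCommGroup ℂ B _ _ _ c
  let : InnerProductSpace ℂ B := InnerProductSpace.ofCore c.toCore
  have : FiniteDimensional ℂ (Submodule.span ℂ T) := FiniteDimensional.span_of_finite ℂ hT
  let b := stdOrthonormalBasis ℂ (Submodule.span ℂ T)
  have key : ∀ p q, c.inner (b p : B) (b q : B) = if p = q then 1 else 0 :=
    orthonormal_iff_ite.1 b.orthonormal
  refine ⟨Set.range fun p => (b p : B), ?_, ?_, fun x hx => ?_⟩
  · rintro _ ⟨p, rfl⟩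
    rw [key, if_pos rfl]
  · rintro _ ⟨p, rfl⟩ _ ⟨q, rfl⟩ h
    rw [key, if_neg fun hpq => h (by rw [hpq])]
  · have h := b.sum_repr ⟨x, Submodule.subset_span hx⟩
    have h' := congrArg (Submodule.span ℂ T).subtype h
    rw [map_sum] at h'
    have h2 : (Submodule.span ℂ T).subtype ⟨x, Submodule.subset_span hx⟩ = x := rfl
    rw [h2] at h'
    rw [← h']
    refine Submodule.sum_mem _ fun p _ => ?_
    rw [map_smul]
    exact Submodule.smul_mem _ _ (Submodule.subset_span ⟨p, rfl⟩)

end Core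

/-! ### Norm, involution and unitaries in one Hilbert algebra -/

section Norm

variable {B : Type v} [Ring B] [StarRing B] [Algebra ℂ B]

theorem hNorm_nonneg (c : InnerProductSpace.Core ℂ B) (x : B) : 0 ≤ hNorm c x :=
  Real.sqrt_nonneg _

theorem hNorm_add_le (c : InnerProductSpace.Core ℂ B) (x y : B) :
    hNorm c (x + y) ≤ hNorm c x + hNorm c y :=
  letI : NormedAddCommGroup B := @InnerProductSpace.Core.toNormedAddCommGroup ℂ B _ _ _ c
  norm_add_le x y

theorem hNorm_smul (c : InnerProductSpace.Core ℂ B) (r : ℂ) (x : B) :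
    hNorm c (r • x) = ‖r‖ * hNorm c x :=
  letI : NormedAddCommGroup B := @InnerProductSpace.Core.toNormedAddCommGroup ℂ B _ _ _ c
  letI : InnerProductSpace ℂ B := InnerProductSpace.ofCore c.toCore
  norm_smul r x

theorem hNorm_zero (c : InnerProductSpace.Core ℂ B) : hNorm c 0 = 0 :=
  letI : NormedAddCommGroup B := @InnerProductSpace.Core.toNormedAddCommGroup ℂ B _ _ _ c
  norm_zero (E := B)

theorem hNorm_sq (c : InnerProductSpace.Core ℂ B) (x : B) :
    hNorm c x ^ 2 = (c.inner x x).re :=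
  Real.sq_sqrt (c.re_inner_nonneg x)

theorem inner_self_of_hNorm_eq_one {c : InnerProductSpace.Core ℂ B} {x : B}
    (h : hNorm c x = 1) : c.inner x x = 1 := by
  rw [← core_inner_self_ofReal, ← hNorm_sq, h]
  simp

variable [StarModule ℂ B]

/-- In a Hilbert algebra the involution is anti-unitary. -/
theorem IsHilbertAlgebra.inner_star_star {c : InnerProductSpace.Core ℂ B}
    (hc : IsHilbertAlgebra c) (x y : B) : c.inner (star x) (star y) = c.inner y x := by
  have hn : ∀ z, (c.inner (star z) (star z)).re = (c.inner z z).re := fun z => by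
    rw [← hNorm_sq, ← hNorm_sq, hc.norm_star]
  have hre : ∀ z w, (c.inner (star z) (star w)).re = (c.inner w z).re := fun z w => by
    -- Polarization: the cross terms of `‖z + w‖²` give the real part.
    have h := hn (z + w)
    rw [star_add, core_add_left, core_add_right, core_add_right, core_add_left, core_add_right,
      core_add_right, ← core_conj_symm c (star w) (star z), ← core_conj_symm c z w] at h
    simp only [Complex.add_re, Complex.conj_re] at h
    linarith [hn z, hn w]
  refine Complex.ext (hre x y) ?_
  -- Multiplying one argument by `I` turns the imaginary part into a real part.
  have h := hre (Complex.I • x) y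
  rw [star_smul, core_smul_left, core_smul_right] at h
  simpa using h

/-- Unitaries act isometrically by left multiplication. -/
theorem IsHilbertAlgebra.inner_unitary_mul {c : InnerProductSpace.Core ℂ B}
    (hc : IsHilbertAlgebra c) (w : unitary B) (x y : B) :
    c.inner (w * x) (w * y) = c.inner x y := by
  rw [hc.inner_mul_left, ← mul_assoc, Unitary.coe_star_mul_self, one_mul]

theorem IsHilbertAlgebra.inner_unitary_self {c : InnerProductSpace.Core ℂ B}
    (hc : IsHilbertAlgebra c) (he : hNorm c 1 = 1) (w : unitary B) :
    c.inner (w : B) (w : B) = 1 := by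
  rw [← inner_self_of_hNorm_eq_one he]
  simpa using hc.inner_unitary_mul w 1 1

end Norm

/-! ### Vanishing and conjugation for `φ₁` -/

section Phi

variable {I : Type u}

theorem phiOneFun_one : phiOneFun (fun _ : I => 1) = 1 := by
  simp [phiOneFun]

theorem phiOneFun_eq_zero_of_infinite {β : I → ℂ} (h : {i | β i ≠ 1}.Infinite) :
    phiOneFun β = 0 :=
  if_neg h

/-- Multilinearity gives this whether or not the family is almost everywhere `1`. -/
theorem phiOneFun_eq_zero {β : I → ℂ} (i : I) (h : β i = 0) : phiOneFun β = 0 :=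
  (phiOneMulti I).map_coord_zero i h

/-- Conjugation fixes `1`, so both families fall in the same case of the definition. -/
theorem phiOneFun_conj (β : I → ℂ) : phiOneFun (fun i => conj (β i)) = conj (phiOneFun β) := by
  have h : ∀ i, conj (β i) ≠ 1 ↔ β i ≠ 1 := fun i => by
    rw [Ne, Ne, map_eq_one_iff _ (starRingEnd ℂ).injective]
  by_cases hf : {i | β i ≠ 1}.Finite
  · rw [phiOneFun, phiOneFun, if_pos hf, if_pos (by simpa only [h] using hf)]
    exact (((starRingEnd ℂ) : ℂ →* ℂ).map_finprod (f := β) hf).symm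
  · rw [phiOneFun, phiOneFun, if_neg hf, if_neg (by simpa only [h] using hf), map_zero]

end Phi

/-! ### Algebraic identities of the form on the full tensor product -/

section Form

variable {I : Type u} {A : I → Type v} [∀ i, Ring (A i)] [∀ i, StarRing (A i)]
  [∀ i, Algebra ℂ (A i)] [∀ i, StarModule ℂ (A i)] (c : ∀ i, InnerProductSpace.Core ℂ (A i))

theorem innerPhiOne_add_left (x y z : ⨂[ℂ] i, A i) :
    innerPhiOne c (x + y) z = innerPhiOne c x z + innerPhiOne c y z := by
  simp [innerPhiOne]

theorem innerPhiOne_add_right (x y z : ⨂[ℂ] i, A i) :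
    innerPhiOne c x (y + z) = innerPhiOne c x y + innerPhiOne c x z := by
  simp [innerPhiOne]

theorem innerPhiOne_smul_left (r : ℂ) (x y : ⨂[ℂ] i, A i) :
    innerPhiOne c (r • x) y = conj r * innerPhiOne c x y := by
  simp [innerPhiOne]

theorem innerPhiOne_smul_right (r : ℂ) (x y : ⨂[ℂ] i, A i) :
    innerPhiOne c x (r • y) = r * innerPhiOne c x y := by
  simp [innerPhiOne]

theorem innerPhiOne_sum_sum {α : Type*} (s : Finset α) (f g : α → ⨂[ℂ] i, A i) :
    innerPhiOne c (∑ p ∈ s, f p) (∑ q ∈ s, g q) =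
      ∑ p ∈ s, ∑ q ∈ s, innerPhiOne c (f p) (g q) := by
  simp only [innerPhiOne, map_sum, LinearMap.sum_apply]
  exact Finset.sum_comm

theorem innerPhiOne_conj_symm (x y : ⨂[ℂ] i, A i) :
    conj (innerPhiOne c y x) = innerPhiOne c x y := by
  induction x using PiTensorProduct.induction_on with
  | smul_tprod r a =>
    induction y using PiTensorProduct.induction_on with
    | smul_tprod t b =>
      simp only [innerPhiOne_smul_left, innerPhiOne_smul_right, innerPhiOne_tprod, map_mul,
        ← phiOneFun_conj, core_conj_symm, Complex.conj_conj]
      ring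
    | add y z hy hz => rw [innerPhiOne_add_left, innerPhiOne_add_right, map_add, hy, hz]
  | add x z hx hz => rw [innerPhiOne_add_left, innerPhiOne_add_right, map_add, hx, hz]

variable {c}

theorem innerPhiOne_mul_left (hc : ∀ i, IsHilbertAlgebra (c i)) (x y z : ⨂[ℂ] i, A i) :
    innerPhiOne c (x * y) z = innerPhiOne c y (star x * z) := by
  induction x using PiTensorProduct.induction_on with
  | smul_tprod r a =>
    rw [star_smul, smul_mul_assoc, smul_mul_assoc, innerPhiOne_smul_left, innerPhiOne_smul_right]
    refine congrArg _ ?_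
    induction y using PiTensorProduct.induction_on with
    | smul_tprod t b =>
      rw [mul_smul_comm, innerPhiOne_smul_left, innerPhiOne_smul_left]
      refine congrArg _ ?_
      induction z using PiTensorProduct.induction_on with
      | smul_tprod s d =>
        rw [mul_smul_comm, innerPhiOne_smul_right, innerPhiOne_smul_right, star_tprod,
          PiTensorProduct.tprod_mul_tprod, PiTensorProduct.tprod_mul_tprod, innerPhiOne_tprod,
          innerPhiOne_tprod]
        simp only [Pi.mul_apply, Pi.star_apply, (hc _).inner_mul_left]
      | add y z hy hz => rw [mul_add, innerPhiOne_add_right, innerPhiOne_add_right, hy, hz]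
    | add y z hy hz => rw [mul_add, innerPhiOne_add_left, innerPhiOne_add_left, hy, hz]
  | add x z hx hz =>
    rw [star_add, add_mul, add_mul, innerPhiOne_add_left, innerPhiOne_add_right, hx, hz]

theorem innerPhiOne_star_star (hc : ∀ i, IsHilbertAlgebra (c i)) (x y : ⨂[ℂ] i, A i) :
    innerPhiOne c (star x) (star y) = innerPhiOne c y x := by
  induction x using PiTensorProduct.induction_on with
  | smul_tprod r a =>
    induction y using PiTensorProduct.induction_on with
    | smul_tprod t b =>
      simp only [star_smul_tprod, innerPhiOne_smul_left, innerPhiOne_smul_right,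
        innerPhiOne_tprod, Pi.star_apply, (hc _).inner_star_star, Complex.conj_conj]
      ring
    | add y z hy hz => rw [star_add, innerPhiOne_add_left, innerPhiOne_add_right, hy, hz]
  | add x z hx hz => rw [star_add, innerPhiOne_add_left, innerPhiOne_add_right, hx, hz]

end Form

/-! ### Orthonormal decomposition with coefficients in one factor -/

section Decomposition

variable {I : Type u} [DecidableEq I] {A : I → Type v} [∀ i, Ring (A i)] [∀ i, StarRing (A i)]
  [∀ i, Algebra ℂ (A i)] [∀ i, StarModule ℂ (A i)] {c : ∀ i, InnerProductSpace.Core ℂ (A i)}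

/-- A set of families is orthonormal off `j` if its elements are `1` at `j` and the corresponding
elementary tensors are orthonormal. -/
structure OrthonormalOff (c : ∀ i, InnerProductSpace.Core ℂ (A i)) (j : I)
    (Z : Set (∀ i, A i)) : Prop where
  one : ∀ w ∈ Z, w j = 1
  self : ∀ w ∈ Z, phiOneFun (fun i => (c i).inner (w i) (w i)) = 1
  ne : ∀ w ∈ Z, ∀ w' ∈ Z, w ≠ w' → phiOneFun (fun i => (c i).inner (w i) (w' i)) = 0

/-- Multilinearity of `φ₁` extracts the factor at `j` and leaves `1` there; by `h` this is the
original entry of the family. -/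
theorem innerPhiOne_tprod_update (w w' : ∀ i, A i) (j : I) (a b : A j)
    (h : (c j).inner (w j) (w' j) = 1) :
    innerPhiOne c (PiTensorProduct.tprod ℂ (Function.update w j a))
      (PiTensorProduct.tprod ℂ (Function.update w' j b)) =
    (c j).inner a b * phiOneFun (fun i => (c i).inner (w i) (w' i)) := by
  have e : ∀ (a b : A j), (fun i => (c i).inner (Function.update w j a i)
      (Function.update w' j b i)) =
      Function.update (fun i => (c i).inner (w i) (w' i)) j ((c j).inner a b) := fun a b => by
    funext i
    by_cases hi : i = j
    · subst hi; simp
    · simp [hi]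
  rw [innerPhiOne_tprod, e, phiOneFun_update, ← h, Function.update_eq_self]

/-- Parseval's identity with coefficients in `A j`: the off-diagonal terms vanish. -/
theorem OrthonormalOff.innerPhiOne_sum {j : I} {Z : Set (∀ i, A i)} (hZ : OrthonormalOff c j Z)
    (he : (c j).inner 1 1 = 1) (s : Finset Z) (f g : Z → A j) :
    innerPhiOne c (∑ w ∈ s, PiTensorProduct.tprod ℂ (Function.update w.1 j (f w)))
      (∑ w ∈ s, PiTensorProduct.tprod ℂ (Function.update w.1 j (g w))) =
    ∑ w ∈ s, (c j).inner (f w) (g w) := by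
  have h1 : ∀ w w' : Z, (c j).inner (w.1 j) (w'.1 j) = 1 := fun w w' => by
    rw [hZ.one _ w.2, hZ.one _ w'.2, he]
  rw [innerPhiOne_sum_sum]
  refine Finset.sum_congr rfl fun w hw => ?_
  rw [Finset.sum_eq_single_of_mem w hw fun w' _ hne => ?_, innerPhiOne_tprod_update _ _ _ _ _
    (h1 w w), hZ.self _ w.2, mul_one]
  rw [innerPhiOne_tprod_update _ _ _ _ _ (h1 w w'),
    hZ.ne _ w.2 _ w'.2 fun h => hne (Subtype.ext h.symm), mul_zero]

/-- If `a i ∈ span (S i)` for `i` in a finite set `F`, then `⊗ a i` is in the span of the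
elementary tensors with entries in `S i` for `i ∈ F` and unchanged entries elsewhere. -/
theorem tprod_mem_span_of_mem_span (S : ∀ i, Set (A i)) (F : Finset I) (a : ∀ i, A i)
    (ha : ∀ i ∈ F, a i ∈ Submodule.span ℂ (S i)) :
    PiTensorProduct.tprod ℂ a ∈ Submodule.span ℂ (PiTensorProduct.tprod ℂ ''
      {w : ∀ i, A i | (∀ i ∈ F, w i ∈ S i) ∧ ∀ i ∉ F, w i = a i}) := by
  induction F using Finset.induction_on with
  | empty => exact Submodule.subset_span ⟨a, ⟨by simp, fun _ _ => rfl⟩, rfl⟩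
  | insert k F hk ih =>
    refine Submodule.span_le.2 ?_ (ih fun i hi => ha i (Finset.mem_insert_of_mem hi))
    rintro _ ⟨w, ⟨hw, hw'⟩, rfl⟩
    have key : ∀ b ∈ Submodule.span ℂ (S k),
        PiTensorProduct.tprod ℂ (Function.update w k b) ∈ Submodule.span ℂ
          (PiTensorProduct.tprod ℂ '' {w : ∀ i, A i | (∀ i ∈ insert k F, w i ∈ S i) ∧
            ∀ i ∉ insert k F, w i = a i}) := by
      intro b hb
      -- The admissible entries at `k` form a subspace, so it suffices to test those in `S k`.
      change b ∈ (Submodule.span ℂ _).comap ((PiTensorProduct.tprod ℂ).toLinearMap w k)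
      refine Submodule.span_le.2 (fun b hb => ?_) hb
      refine Submodule.subset_span (Set.mem_image_of_mem _ (⟨fun i hi => ?_, fun i hi => ?_⟩ :
        (∀ i ∈ insert k F, Function.update w k b i ∈ S i) ∧
          ∀ i ∉ insert k F, Function.update w k b i = a i))
      · by_cases hik : i = k
        · subst hik; simpa using hb
        · simpa [hik] using hw i (by simpa [hik] using hi)
      · rw [Finset.mem_insert, not_or] at hi
        simpa [hi.1] using hw' i hi.2
    have := key (w k) (by rw [hw' k hk]; exact ha k (Finset.mem_insert_self k F))
    rwa [Function.update_eq_self] at this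

theorem utSubmodule_eq_span : utSubmodule A = Submodule.span ℂ (PiTensorProduct.tprod ℂ ''
    {a : ∀ i, A i | ∃ w : ∀ i, unitary (A i), {i | a i ≠ w i}.Finite}) := by
  refine le_antisymm (fun x hx => ?_) (Submodule.span_le.2 ?_)
  · refine utSubmodule_induction (p := fun x => x ∈ Submodule.span ℂ _) (fun w a ha => ?_)
      (zero_mem _) (fun _ _ => add_mem) (fun r _ => Submodule.smul_mem _ r) hx
    exact Submodule.subset_span (Set.mem_image_of_mem _ ⟨w, ha⟩)
  · rintro _ ⟨a, ⟨w, ha⟩, rfl⟩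
    exact tprod_mem_utSubmodule w a ha

/-- Finitely many almost unitary families agree, off a common finite set, as soon as they agree
almost everywhere, and are unitary there. -/
theorem exists_finset_common (T : Finset (∀ i, A i))
    (hT : ∀ a ∈ T, ∃ w : ∀ i, unitary (A i), {i | a i ≠ w i}.Finite) :
    ∃ F : Finset I, (∀ a ∈ T, ∀ i ∉ F, a i ∈ unitary (A i)) ∧
      ∀ a ∈ T, ∀ b ∈ T, {i | a i ≠ b i}.Finite → ∀ i ∉ F, a i = b i := by
  classical
  have h1 : (⋃ a ∈ T, {i | a i ∉ unitary (A i)}).Finite := by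
    refine T.finite_toSet.biUnion fun a ha => ?_
    obtain ⟨w, hw⟩ := hT a ha
    exact hw.subset fun i hi h => hi (h ▸ (w i).2)
  have h2 : (⋃ p ∈ (T ×ˢ T).filter fun p : (∀ i, A i) × (∀ i, A i) => {i | p.1 i ≠ p.2 i}.Finite,
      {i | p.1 i ≠ p.2 i}).Finite :=
    (Finset.finite_toSet _).biUnion fun p hp => (Finset.mem_filter.1 hp).2
  refine ⟨(h1.union h2).toFinset, fun a ha i hi => ?_, fun a ha b hb hab i hi => ?_⟩
  · by_contra h
    exact hi ((Set.Finite.mem_toFinset _).2 (Or.inl (Set.mem_biUnion ha h)))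
  · by_contra h
    refine hi ((Set.Finite.mem_toFinset _).2 (Or.inr (Set.mem_biUnion (x := (a, b)) ?_ h)))
    exact Finset.mem_filter.2 ⟨Finset.mem_product.2 ⟨ha, hb⟩, hab⟩

/-- Every element of `⨂^ut A i` is a finite sum of elementary tensors that are orthonormal
when the entry at `j` is disregarded. -/
theorem exists_orthonormalOff (hc : ∀ i, IsHilbertAlgebra (c i)) (he : ∀ i, hNorm (c i) 1 = 1)
    (j : I) {x : ⨂[ℂ] i, A i} (hx : x ∈ utSubmodule A) :
    ∃ Z : Set (∀ i, A i), OrthonormalOff c j Z ∧ ∃ (s : Finset Z) (f : Z → A j),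
      x = ∑ w ∈ s, PiTensorProduct.tprod ℂ (Function.update w.1 j (f w)) := by
  classical
  rw [utSubmodule_eq_span] at hx
  obtain ⟨T', hT', hxT⟩ := Submodule.mem_span_finite_of_mem_span hx
  obtain ⟨T, hT, rfl⟩ := Finset.subset_set_image_iff.1 hT'
  obtain ⟨F, hFu, hF⟩ := exists_finset_common T hT
  choose S hS1 hS0 hS using fun i => exists_orthonormal_span (c i) ((fun a : ∀ i, A i => a i) '' T)
    (T.finite_toSet.image _)
  -- Entries are basis vectors on `F` away from `j`, copies of some `a ∈ T` off `F`, and `1` at `j`,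
  -- whose true entry will become the coefficient.
  let Z : Set (∀ i, A i) := {w | w j = 1 ∧ ∃ a ∈ T, (∀ i ∈ F.erase j, w i ∈ S i) ∧
    ∀ i ∉ F, i ≠ j → w i = a i}
  have hone : ∀ w ∈ Z, ∀ i, (c i).inner (w i) (w i) = 1 := by
    rintro w ⟨hwj, a, ha, hw, hw'⟩ i
    by_cases hij : i = j
    · subst hij
      rw [hwj, inner_self_of_hNorm_eq_one (he i)]
    by_cases hi : i ∈ F
    · exact hS1 i _ (hw i (Finset.mem_erase.2 ⟨hij, hi⟩))
    · rw [hw' i hi hij]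
      exact (hc i).inner_unitary_self (he i) ⟨a i, hFu a ha i hi⟩
  have hZ : OrthonormalOff c j Z := by
    refine ⟨fun w hw => hw.1, fun w hw => ?_, fun w hw w' hw' hne => ?_⟩
    · simp only [hone w hw, phiOneFun_one]
    · have h1 := hone w hw
      have h1' := hone w' hw'
      -- If almost all inner products are `1`, then `w` and `w'`, hence `a` and `a'`, agree almost
      -- everywhere. The choice of `F` makes `a` and `a'` equal off `F`, so `w` and `w'` differ at
      -- some index of `F` other than `j`, where they are orthogonal.
      by_cases hfin : {i | (c i).inner (w i) (w' i) ≠ 1}.Finite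
      · obtain ⟨hj, a, ha, hwS, hwa⟩ := hw
        obtain ⟨hj', a', ha', hwS', hwa'⟩ := hw'
        have hww : {i | w i ≠ w' i}.Finite := hfin.subset fun i hi h =>
          hi (core_eq_of_inner_eq_one (c i) (h1 i) (h1' i) h)
        have haa : {i | a i ≠ a' i}.Finite := by
          refine ((hww.union F.finite_toSet).union (Set.finite_singleton j)).subset fun i hi => ?_
          by_contra hcon
          simp only [Set.mem_union, not_or] at hcon
          refine hi ?_
          rw [← hwa i hcon.1.2 hcon.2, ← hwa' i hcon.1.2 hcon.2]
          exact not_not.1 hcon.1.1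
        obtain ⟨i, hi⟩ := Function.ne_iff.1 hne
        have hij : i ≠ j := by
          rintro rfl
          exact hi (hj.trans hj'.symm)
        have hiF : i ∈ F := by
          by_contra h
          exact hi (by rw [hwa i h hij, hwa' i h hij, hF a ha a' ha' haa i h])
        have hiF' := Finset.mem_erase.2 ⟨hij, hiF⟩
        exact phiOneFun_eq_zero i (hS0 i _ (hwS i hiF') _ (hwS' i hiF') hi)
      · exact phiOneFun_eq_zero_of_infinite hfin
  refine ⟨Z, hZ, ?_⟩
  -- The range of `L` is a subspace, so only the spanning tensors have to be reached.
  let L : (Z →₀ A j) →ₗ[ℂ] ⨂[ℂ] i, A i :=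
    Finsupp.lsum ℂ fun w : Z => (PiTensorProduct.tprod ℂ).toLinearMap w.1 j
  have hL : x ∈ LinearMap.range L := by
    refine Submodule.span_le.2 ?_ hxT
    intro y hy
    obtain ⟨a, ha, rfl⟩ := Finset.mem_image.1 hy
    refine Submodule.span_le.2 ?_ (tprod_mem_span_of_mem_span S (F.erase j) a
      fun i _ => hS i ⟨a, ha, rfl⟩)
    rintro _ ⟨w, ⟨hw, hw'⟩, rfl⟩
    have hwZ : Function.update w j 1 ∈ Z := by
      refine ⟨by simp, a, ha, fun i hi => ?_, fun i hi hij => ?_⟩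
      · rw [Function.update_of_ne (Finset.mem_erase.1 hi).1]
        exact hw i hi
      · rw [Function.update_of_ne hij]
        exact hw' i fun h => hi (Finset.mem_erase.1 h).2
    -- The entry of `w` at `j`, replaced by `1` in the index family, returns as the coefficient.
    refine ⟨Finsupp.single ⟨_, hwZ⟩ (w j), ?_⟩
    simp [L]
  obtain ⟨f, rfl⟩ := hL
  exact ⟨f.support, f, rfl⟩

end Decomposition

/-! ### The Hilbert algebra structure on `⨂^ut A i` -/

section HilbertTensor

variable {I : Type u} {A : I → Type v} [∀ i, Ring (A i)] [∀ i, StarRing (A i)]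
  [∀ i, Algebra ℂ (A i)] [∀ i, StarModule ℂ (A i)] {c : ∀ i, InnerProductSpace.Core ℂ (A i)}

theorem innerPhiOne_self_nonneg [Nonempty I] (hc : ∀ i, IsHilbertAlgebra (c i))
    (he : ∀ i, hNorm (c i) 1 = 1) {x : ⨂[ℂ] i, A i} (hx : x ∈ utSubmodule A) :
    0 ≤ (innerPhiOne c x x).re := by
  classical
  obtain ⟨j⟩ := ‹Nonempty I›
  obtain ⟨Z, hZ, s, f, rfl⟩ := exists_orthonormalOff hc he j hx
  rw [hZ.innerPhiOne_sum (inner_self_of_hNorm_eq_one (he j)), Complex.re_sum]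
  exact Finset.sum_nonneg fun w _ => (c j).re_inner_nonneg _

theorem innerPhiOne_definite [Nonempty I] (hc : ∀ i, IsHilbertAlgebra (c i))
    (he : ∀ i, hNorm (c i) 1 = 1) {x : ⨂[ℂ] i, A i} (hx : x ∈ utSubmodule A)
    (h : innerPhiOne c x x = 0) : x = 0 := by
  classical
  obtain ⟨j⟩ := ‹Nonempty I›
  obtain ⟨Z, hZ, s, f, rfl⟩ := exists_orthonormalOff hc he j hx
  rw [hZ.innerPhiOne_sum (inner_self_of_hNorm_eq_one (he j))] at h
  have h' := congrArg Complex.re h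
  have hpos : ∀ w ∈ s, 0 ≤ ((c j).inner (f w) (f w)).re := fun w _ => (c j).re_inner_nonneg _
  rw [Complex.re_sum, Complex.zero_re, Finset.sum_eq_zero_iff_of_nonneg hpos] at h'
  -- Each coefficient has norm zero, hence vanishes, and a zero entry kills its tensor.
  refine Finset.sum_eq_zero fun w hw => MultilinearMap.map_coord_zero _ j ?_
  rw [Function.update_self]
  refine (c j).definite _ ?_
  change (c j).inner (f w) (f w) = 0
  rw [← core_inner_self_ofReal, h' w hw, Complex.ofReal_zero]

/-- The inner product on `⨂^ut A i`. -/
@[reducible]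
def utCore [Nonempty I] (hc : ∀ i, IsHilbertAlgebra (c i)) (he : ∀ i, hNorm (c i) 1 = 1) :
    InnerProductSpace.Core ℂ (utTensor A) where
  inner x y := innerPhiOne c (x : ⨂[ℂ] i, A i) y
  conj_inner_symm _ _ := innerPhiOne_conj_symm c _ _
  re_inner_nonneg x := innerPhiOne_self_nonneg hc he x.2
  add_left _ _ _ := innerPhiOne_add_left c _ _ _
  smul_left _ _ _ := innerPhiOne_smul_left c _ _ _
  definite x h := Subtype.ext (innerPhiOne_definite hc he x.2 h)

/-- Left multiplication by an element of a single tensor factor is bounded. -/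
theorem innerPhiOne_single_mul_le [DecidableEq I] (hc : ∀ i, IsHilbertAlgebra (c i))
    (he : ∀ i, hNorm (c i) 1 = 1) (j : I) (a : A j) :
    ∃ C : ℝ, ∀ y ∈ utSubmodule A,
      (innerPhiOne c (PiTensorProduct.tprod ℂ (Function.update 1 j a) * y)
        (PiTensorProduct.tprod ℂ (Function.update 1 j a) * y)).re ≤
      C * (innerPhiOne c y y).re := by
  obtain ⟨C, hC⟩ := (hc j).bounded_mul_left a
  -- The square appears because the estimate compares squared norms.
  refine ⟨C ^ 2, fun y hy => ?_⟩
  obtain ⟨Z, hZ, s, f, rfl⟩ := exists_orthonormalOff hc he j hy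
  have hmul : ∀ w : Z, PiTensorProduct.tprod ℂ (Function.update 1 j a) *
      PiTensorProduct.tprod ℂ (Function.update w.1 j (f w)) =
      PiTensorProduct.tprod ℂ (Function.update w.1 j (a * f w)) := fun w => by
    rw [PiTensorProduct.tprod_mul_tprod, ← Function.update_mul, one_mul]
  have h1 := inner_self_of_hNorm_eq_one (he j)
  rw [Finset.mul_sum]
  simp only [hmul]
  rw [hZ.innerPhiOne_sum h1, hZ.innerPhiOne_sum h1, Complex.re_sum, Complex.re_sum,
    Finset.mul_sum]
  refine Finset.sum_le_sum fun w _ => ?_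
  rw [← hNorm_sq, ← hNorm_sq, ← mul_pow]
  exact pow_le_pow_left₀ (hNorm_nonneg _ _) (hC _) 2

/-- Left multiplication by an almost unitary elementary tensor is bounded. -/
theorem innerPhiOne_tprod_mul_le (hc : ∀ i, IsHilbertAlgebra (c i))
    (he : ∀ i, hNorm (c i) 1 = 1) (w : ∀ i, unitary (A i)) (F : Finset I) (a : ∀ i, A i)
    (ha : ∀ i ∉ F, a i = w i) :
    ∃ C : ℝ, 0 ≤ C ∧ ∀ y ∈ utSubmodule A,
      (innerPhiOne c (PiTensorProduct.tprod ℂ a * y) (PiTensorProduct.tprod ℂ a * y)).re ≤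
      C * (innerPhiOne c y y).re := by
  classical
  induction F using Finset.induction_on generalizing a with
  | empty =>
    -- Here the tensor is unitary, so multiplication by it is isometric.
    refine ⟨1, zero_le_one, fun y _ => le_of_eq ?_⟩
    obtain rfl : a = fun i => (w i : A i) := funext fun i => ha i (Finset.notMem_empty i)
    have h : star (PiTensorProduct.tprod ℂ fun i => (w i : A i)) *
        PiTensorProduct.tprod ℂ (fun i => (w i : A i)) = 1 := by
      rw [star_tprod, PiTensorProduct.tprod_mul_tprod]
      refine congrArg _ (funext fun i => ?_)
      exact Unitary.coe_star_mul_self (w i)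
    rw [innerPhiOne_mul_left hc, ← mul_assoc, h, one_mul, one_mul]
  | insert j F hj ih =>
    obtain ⟨C, hC0, hC⟩ := ih (Function.update a j (w j)) fun i hi => by
      by_cases hij : i = j
      · subst hij; simp
      · rw [Function.update_of_ne hij]
        exact ha i (by simp [hij, hi])
    -- Since `a j = (a j * star (w j)) * w j`, the entry at `j` can be made unitary at the cost of
    -- one single-factor multiplication.
    obtain ⟨D, hD⟩ := innerPhiOne_single_mul_le hc he j (a j * star (w j : A j))
    have hmem : PiTensorProduct.tprod ℂ (Function.update a j (w j)) ∈ utSubmodule A := by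
      refine tprod_mem_utSubmodule w _ (F.finite_toSet.subset fun i hi => ?_)
      by_contra hiF
      refine hi ?_
      by_cases hij : i = j
      · subst hij; simp
      · rw [Function.update_of_ne hij]
        exact ha i (by simpa [hij] using hiF)
    have hfac : PiTensorProduct.tprod ℂ a =
        PiTensorProduct.tprod ℂ (Function.update 1 j (a j * star (w j : A j))) *
          PiTensorProduct.tprod ℂ (Function.update a j (w j)) := by
      rw [PiTensorProduct.tprod_mul_tprod, ← Function.update_mul, one_mul, mul_assoc,
        Unitary.coe_star_mul_self, mul_one, Function.update_eq_self]
    have : Nonempty I := ⟨j⟩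
    -- `D` carries no sign information; `max D 0` makes the bound monotone.
    refine ⟨max D 0 * C, mul_nonneg (le_max_right _ _) hC0, fun y hy => ?_⟩
    have hy' := ut_mul_mem hmem hy
    rw [hfac, mul_assoc, mul_assoc]
    exact (hD _ hy').trans ((mul_le_mul_of_nonneg_right (le_max_left D 0)
      (innerPhiOne_self_nonneg hc he hy')).trans
        (mul_le_mul_of_nonneg_left (hC y hy) (le_max_right _ _)))

theorem utCore_bounded_mul_left [Nonempty I] (hc : ∀ i, IsHilbertAlgebra (c i))
    (he : ∀ i, hNorm (c i) 1 = 1) (x : utTensor A) :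
    ∃ C : ℝ, ∀ y, hNorm (utCore hc he) (x * y) ≤ C * hNorm (utCore hc he) y := by
  obtain ⟨x, hx⟩ := x
  -- Membership is carried along in the induction so that the summands of `z` can be regarded as
  -- elements of `utTensor A`.
  have key : ∀ z ∈ utSubmodule A, z ∈ utSubmodule A ∧ ∀ hz : z ∈ utTensor A,
      ∃ C : ℝ, ∀ y, hNorm (utCore hc he) (⟨z, hz⟩ * y) ≤ C * hNorm (utCore hc he) y := by
    intro z hz
    refine utSubmodule_induction (p := fun z => z ∈ utSubmodule A ∧ ∀ hz : z ∈ utTensor A,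
      ∃ C : ℝ, ∀ y, hNorm (utCore hc he) (⟨z, hz⟩ * y) ≤ C * hNorm (utCore hc he) y)
      (fun w a ha => ⟨tprod_mem_utSubmodule w a ha, fun hz => ?_⟩)
      ⟨zero_mem _, fun hz => ⟨0, fun y => ?_⟩⟩ (fun z z' h h' => ⟨add_mem h.1 h'.1, fun hz => ?_⟩)
      (fun r z h => ⟨Submodule.smul_mem _ r h.1, fun hz => ?_⟩) hz
    · obtain ⟨C, hC0, hC⟩ := innerPhiOne_tprod_mul_le hc he w ha.toFinset a (by simp)
      refine ⟨√C, fun y => ?_⟩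
      rw [hNorm, hNorm, ← Real.sqrt_mul hC0]
      exact Real.sqrt_le_sqrt (hC y y.2)
    · have : (⟨0, hz⟩ : utTensor A) = 0 := rfl
      rw [this, zero_mul, zero_mul, hNorm_zero]
    · obtain ⟨C, hC⟩ := h.2 h.1
      obtain ⟨C', hC'⟩ := h'.2 h'.1
      refine ⟨C + C', fun y => ?_⟩
      have : (⟨z + z', hz⟩ : utTensor A) = ⟨z, h.1⟩ + ⟨z', h'.1⟩ := rfl
      rw [this, add_mul, add_mul]
      exact (hNorm_add_le _ _ _).trans (add_le_add (hC y) (hC' y))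
    · obtain ⟨C, hC⟩ := h.2 h.1
      refine ⟨‖r‖ * C, fun y => ?_⟩
      have : (⟨r • z, hz⟩ : utTensor A) = r • ⟨z, h.1⟩ := rfl
      rw [this, smul_mul_assoc, hNorm_smul, mul_assoc]
      exact mul_le_mul_of_nonneg_left (hC y) (norm_nonneg r)
  exact (key x hx).2 hx

theorem utCore_isHilbertAlgebra [Nonempty I] (hc : ∀ i, IsHilbertAlgebra (c i))
    (he : ∀ i, hNorm (c i) 1 = 1) : IsHilbertAlgebra (utCore hc he) where
  bounded_mul_left := utCore_bounded_mul_left hc he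
  inner_mul_left x y z := innerPhiOne_mul_left hc x.1 y.1 z.1
  dense_mul x ε hε := by
    -- Density is immediate from the unit: `x = x * 1` is itself a product.
    refine ⟨x, Submodule.subset_span ⟨x, 1, (mul_one x).symm⟩, ?_⟩
    rwa [sub_self, hNorm_zero]
  norm_star x := congrArg (fun z : ℂ => √z.re) (innerPhiOne_star_star hc x.1 x.1)

theorem hNorm_utCore_utUnit [Nonempty I] (hc : ∀ i, IsHilbertAlgebra (c i))
    (he : ∀ i, hNorm (c i) 1 = 1) : hNorm (utCore hc he) (utUnit A) = 1 := by
  have h : innerPhiOne c (PiTensorProduct.tprod ℂ fun i => (1 : A i))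
      (PiTensorProduct.tprod ℂ fun i => (1 : A i)) = 1 := by
    rw [innerPhiOne_tprod]
    simp only [inner_self_of_hNorm_eq_one (he _), phiOneFun_one]
  change √(innerPhiOne c (PiTensorProduct.tprod ℂ fun i => (1 : A i))
    (PiTensorProduct.tprod ℂ fun i => (1 : A i))).re = 1
  rw [h]
  simp

end HilbertTensor

end InfTensor

end

theorem mainTheorem11 {I : Type*} [Infinite I] {A : I → Type*}
    [∀ i, Ring (A i)] [∀ i, StarRing (A i)] [∀ i, Algebra ℂ (A i)] [∀ i, StarModule ℂ (A i)]
    (c : ∀ i, InnerProductSpace.Core ℂ (A i))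
    (hc : ∀ i, InfTensor.IsHilbertAlgebra (c i))
    (he : ∀ i, InfTensor.hNorm (c i) 1 = 1) :
    ∃ C : InnerProductSpace.Core ℂ (InfTensor.utTensor A),
      (∀ x y : InfTensor.utTensor A, C.inner x y =
        InfTensor.innerPhiOne c (x : PiTensorProduct ℂ A) (y : PiTensorProduct ℂ A)) ∧
      InfTensor.IsHilbertAlgebra C ∧
      InfTensor.hNorm C (InfTensor.utUnit A) = 1 :=
  ⟨InfTensor.utCore hc he, fun _ _ => rfl, InfTensor.utCore_isHilbertAlgebra hc he,
    InfTensor.hNorm_utCore_utUnit hc he⟩
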